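/- Let $(\Omega,\mathcal A,\mu)$ be a probability space, $E$ a separable real Banach space with dual $E'$ and closed dual unit ball $B_{E'}$, and let $X:\Omega\to E$ be a Gaussian random variable (strongly measurable, with every $e'(X)$, $e'\in E'$, a possibly degenerate real Gaussian) with $\mathbb E(X)=0$. For a centred Gaussian random variable $V:\Omega\to E$ let $\mathrm{cov}(V):E'\to E$, $\mathrm{cov}(V)e'=\mathbb E(e'(V)V)$, be its covariance operator and let $k_V(e_1',e_2')=\langle \mathrm{cov}(V)e_1',e_2'\rangle$, $e_1',e_2'\in B_{E'}$, be its kernel. Let $G_X$ be the closure of $\{e'(X): e'\in E'\}$ in $L^2(\mu)$, and let $H_X$ be the reproducing kernel Hilbert space of $k_X$, that is, the space of all functions $h_g: B_{E'}\to\mathbb R$, $h_g(e')=e'\bigl(\int_\Omega gX\,d\mu\bigr)$, with $g\in G_X$, normed by $\|h_g\|_{H_X}=\|g\|_{L^2(\mu)}$. Let $\mathcal E\subset B_{E'}$ be arbitrary, let $H(\mathcal E)$ be the closure in $H_X$ of $\mathrm{span}\{k_X(\cdot,e'): e'\in\mathcal E\}$ with orthogonal projection $\Pi_{H(\mathcal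 E)}:H_X\to H_X$, and let $X_{\mathcal E}$ be any version of the conditional expectation $\mathbb E\bigl(X\mid\sigma\{e'(X): e'\in\mathcal E\}\bigr)$. Then: 1. $X_{\mathcal E}$ is a Gaussian random variable with mean zero, and its kernel $k_{\mathcal E}:=k_{X_{\mathcal E}}$ satisfies $k_{\mathcal E}(\cdot,e')\in H_X$ and $k_{\mathcal E}(\cdot,e')=\Pi_{H(\mathcal E)}k_X(\cdot,e')$ for all $e'\in B_{E'}$. 2. $X-X_{\mathcal E}$ is a Gaussian random variable with mean zero, and $k_{X-X_{\mathcal E}}(e_1',e_2')=k_X(e_1',e_2')-k_{\mathcal E}(e_1',e_2')$ for all $e_1',e_2'\in B_{E'}$. 3. $$\sup_{e'\in B_{E'}}\|k_X(\cdot,e')-k_{\mathcal E}(\cdot,e')\|_{H_X}^2=\|\mathrm{cov}(X-X_{\mathcal E})\|_{E'\to E}=\|\mathrm{cov}(X)-\mathrm{cov}(X_{\mathcal E})\|_{E'\to E}.$$ -/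

import Mathlib

open MeasureTheory ProbabilityTheory

namespace GaussianConditioning

noncomputable section

/-- The closed unit ball of the dual space of `E`. -/
abbrev DualBall (E : Type*) [NormedAddCommGroup E] [NormedSpace ℝ E] : Type _ :=
  ↥(Metric.closedBall (0 : StrongDual ℝ E) 1)

section Covariance

variable {Ω E : Type*} [MeasurableSpace Ω] [NormedAddCommGroup E] [NormedSpace ℝ E]

lemma integrable_dual_smul {X : Ω → E} {μ : Measure Ω} (hX : MemLp X 2 μ)
    (e : StrongDual ℝ E) : Integrable (fun ω => e (X ω) • X ω) μ :=
  memLp_one_iff_integrable.1 (hX.smul (e.comp_memLp' hX))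

lemma norm_integral_dual_smul_le {X : Ω → E} {μ : Measure Ω} (hX : MemLp X 2 μ)
    (e : StrongDual ℝ E) : ‖∫ ω, e (X ω) • X ω ∂μ‖ ≤ (∫ ω, ‖X ω‖ ^ 2 ∂μ) * ‖e‖ := by
  rw [mul_comm, ← integral_const_mul]
  refine norm_integral_le_of_norm_le ((hX.integrable_norm_pow two_ne_zero).const_mul _)
    (Filter.Eventually.of_forall fun ω => ?_)
  rw [norm_smul]
  calc ‖e (X ω)‖ * ‖X ω‖ ≤ (‖e‖ * ‖X ω‖) * ‖X ω‖ := by gcongr; exact e.le_opNorm _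
    _ = ‖e‖ * ‖X ω‖ ^ 2 := by ring

open scoped Classical in
/-- The covariance operator `e' ↦ 𝔼 (e'(X) X)` of a centred random variable `X` with finite second
moment, as a bounded operator from the dual of `E` to `E` (zero if `X` is not in `L²`). -/
def cov (X : Ω → E) (μ : Measure Ω) : StrongDual ℝ E →L[ℝ] E :=
  if hX : MemLp X 2 μ then
    LinearMap.mkContinuous
      { toFun := fun e => ∫ ω, e (X ω) • X ω ∂μ
        map_add' := fun e f => by
          have h : ∀ ω, (e + f) (X ω) • X ω = e (X ω) • X ω + f (X ω) • X ω :=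
            fun ω => add_smul _ _ _
          simp only [h]
          exact integral_add (integrable_dual_smul hX e) (integrable_dual_smul hX f)
        map_smul' := fun c e => by
          have h : ∀ ω, (c • e) (X ω) • X ω = c • (e (X ω) • X ω) := fun ω => mul_smul _ _ _
          simp only [h]
          exact integral_smul c _ }
      (∫ ω, ‖X ω‖ ^ 2 ∂μ) (norm_integral_dual_smul_le hX)
  else 0

lemma cov_apply {X : Ω → E} {μ : Measure Ω} (hX : MemLp X 2 μ) (e : StrongDual ℝ E) :
    cov X μ e = ∫ ω, e (X ω) • X ω ∂μ := by
  simp [cov, hX]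

/-- The covariance kernel `k_X(e₁, e₂) = ⟨cov(X) e₁, e₂⟩` on the unit ball of the dual. -/
def covKernel (X : Ω → E) (μ : Measure Ω) (e₁ e₂ : DualBall E) : ℝ :=
  (e₂ : StrongDual ℝ E) (cov X μ (e₁ : StrongDual ℝ E))

end Covariance

section Spaces

variable {Ω E : Type*} [MeasurableSpace Ω] [NormedAddCommGroup E] [NormedSpace ℝ E]
  {X : Ω → E} {μ : Measure Ω}

/-- The map `e' ↦ e'(X)` into `L²`. -/
def dualToL2 (hX : MemLp X 2 μ) : StrongDual ℝ E →ₗ[ℝ] Lp ℝ 2 μ where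
  toFun e := (e.comp_memLp' hX).toLp
  map_add' _ _ := rfl
  map_smul' _ _ := rfl

/-- The Gaussian Hilbert space `G_X`, the `L²`-closure of `{e'(X) | e' ∈ E'}`. -/
def gaussSpace (hX : MemLp X 2 μ) : Submodule ℝ (Lp ℝ 2 μ) :=
  (LinearMap.range (dualToL2 hX)).topologicalClosure

lemma integrable_smul_of_memLp (hX : MemLp X 2 μ) (g : Lp ℝ 2 μ) :
    Integrable (fun ω => g ω • X ω) μ :=
  memLp_one_iff_integrable.1 (hX.smul (Lp.memLp g))

/-- The map `g ↦ ∫ g X dμ` from `G_X` to `E`. -/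
def wienerMap (hX : MemLp X 2 μ) : gaussSpace hX →ₗ[ℝ] E where
  toFun g := ∫ ω, (g : Lp ℝ 2 μ) ω • X ω ∂μ
  map_add' g h := by
    rw [← integral_add (integrable_smul_of_memLp hX _) (integrable_smul_of_memLp hX _)]
    refine integral_congr_ae ?_
    filter_upwards [Lp.coeFn_add (g : Lp ℝ 2 μ) (h : Lp ℝ 2 μ)] with ω hω
    rw [Submodule.coe_add, hω, Pi.add_apply, add_smul]
  map_smul' c g := by
    rw [RingHom.id_apply, ← integral_smul]
    refine integral_congr_ae ?_
    filter_upwards [Lp.coeFn_smul c (g : Lp ℝ 2 μ)] with ω hω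
    rw [Submodule.coe_smul, hω, Pi.smul_apply, smul_eq_mul, mul_smul]

/-- The abstract Wiener space `W_X` of all `∫ g X dμ` with `g ∈ G_X`, as a vector space. -/
def wienerSpace (hX : MemLp X 2 μ) : Submodule ℝ E := LinearMap.range (wienerMap hX)

/-- The map sending `e` to the function `e' ↦ e'(e)` on the unit ball of the dual. -/
def evalOnBall (E : Type*) [NormedAddCommGroup E] [NormedSpace ℝ E] :
    E →ₗ[ℝ] (DualBall E → ℝ) where
  toFun e f := (f : StrongDual ℝ E) e
  map_add' _ _ := by ext; simp
  map_smul' _ _ := by ext; simp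

/-- The space `H_X` of all functions `e' ↦ e'(w)`, `w ∈ W_X`, on the unit ball of the dual. Its
Hilbert space structure, transported from `G_X`, is defined below. -/
def covRKHS (hX : MemLp X 2 μ) : Type _ := ↥((wienerSpace hX).map (evalOnBall E))

instance (hX : MemLp X 2 μ) : AddCommGroup (covRKHS hX) :=
  inferInstanceAs (AddCommGroup ↥((wienerSpace hX).map (evalOnBall E)))

instance (hX : MemLp X 2 μ) : Module ℝ (covRKHS hX) :=
  inferInstanceAs (Module ℝ ↥((wienerSpace hX).map (evalOnBall E)))

/-- An element of `H_X` as a function on the unit ball of the dual. -/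
def covRKHS.toFun (hX : MemLp X 2 μ) : covRKHS hX →ₗ[ℝ] (DualBall E → ℝ) :=
  ((wienerSpace hX).map (evalOnBall E)).subtype

/-- The map sending `g ∈ G_X` to the function `e' ↦ e'(∫ g X dμ)` in `H_X`. -/
def toCovRKHS (hX : MemLp X 2 μ) : gaussSpace hX →ₗ[ℝ] covRKHS hX :=
  LinearMap.codRestrict ((wienerSpace hX).map (evalOnBall E)) (evalOnBall E ∘ₗ wienerMap hX)
    fun g => Submodule.mem_map_of_mem (LinearMap.mem_range_self _ g)

lemma inner_dualToL2 [CompleteSpace E] (hX : MemLp X 2 μ) (e : StrongDual ℝ E)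
    (g : gaussSpace hX) : inner ℝ (g : Lp ℝ 2 μ) (dualToL2 hX e) = e (wienerMap hX g) := by
  rw [L2.inner_def]
  change _ = e (∫ ω, (g : Lp ℝ 2 μ) ω • X ω ∂μ)
  rw [← e.integral_comp_comm (integrable_smul_of_memLp hX _)]
  refine integral_congr_ae ?_
  filter_upwards [(e.comp_memLp' hX).coeFn_toLp] with ω hω
  change inner ℝ _ ((e.comp_memLp' hX).toLp _ ω) = _
  simp [hω, mul_comm]

lemma toFun_toCovRKHS [CompleteSpace E] (hX : MemLp X 2 μ) (g : gaussSpace hX)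
    (e : DualBall E) :
    covRKHS.toFun hX (toCovRKHS hX g) e = inner ℝ (g : Lp ℝ 2 μ) (dualToL2 hX e) :=
  (inner_dualToL2 hX _ g).symm

lemma dualToL2_mem (hX : MemLp X 2 μ) (e : StrongDual ℝ E) : dualToL2 hX e ∈ gaussSpace hX :=
  Submodule.le_topologicalClosure _ (LinearMap.mem_range_self _ e)

lemma toCovRKHS_bijective [CompleteSpace E] (hX : MemLp X 2 μ) :
    Function.Bijective (toCovRKHS hX) := by
  constructor
  · rw [injective_iff_map_eq_zero]
    intro g hg
    have h0 : ∀ e : StrongDual ℝ E, inner ℝ (g : Lp ℝ 2 μ) (dualToL2 hX e) = 0 := by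
      intro e
      obtain ⟨c, hc, hce⟩ : ∃ c : ℝ, c ≠ 0 ∧ c • e ∈ Metric.closedBall (0 : StrongDual ℝ E) 1 := by
        refine ⟨(‖e‖ + 1)⁻¹, by positivity, ?_⟩
        rw [mem_closedBall_zero_iff, norm_smul, norm_inv, Real.norm_of_nonneg (by positivity),
          inv_mul_le_iff₀ (by positivity)]
        linarith
      have := toFun_toCovRKHS hX g ⟨c • e, hce⟩
      rw [hg, map_zero, map_smul, inner_smul_right] at this
      simpa [hc] using this.symm
    have hmem : (g : Lp ℝ 2 μ) ∈ (gaussSpace hX)ᗮ := by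
      change _ ∈ (LinearMap.range (dualToL2 hX)).topologicalClosureᗮ
      rw [Submodule.orthogonal_closure, Submodule.mem_orthogonal']
      rintro _ ⟨e, rfl⟩
      exact h0 e
    have := (gaussSpace hX).inner_right_of_mem_orthogonal g.2 hmem
    exact Subtype.ext (inner_self_eq_zero.1 this)
  · rintro ⟨_, w, ⟨g, rfl⟩, rfl⟩
    exact ⟨g, rfl⟩

/-- The canonical isomorphism between `G_X` and `H_X`. -/
def covRKHSEquiv [CompleteSpace E] (hX : MemLp X 2 μ) : covRKHS hX ≃ₗ[ℝ] gaussSpace hX :=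
  (LinearEquiv.ofBijective (toCovRKHS hX) (toCovRKHS_bijective hX)).symm

/-- The norm of `e' ↦ e'(w)` is the `L²`-norm of the unique `g ∈ G_X` with `w = ∫ g X dμ`. -/
instance [CompleteSpace E] (hX : MemLp X 2 μ) : NormedAddCommGroup (covRKHS hX) :=
  NormedAddCommGroup.induced _ _ (covRKHSEquiv hX) (covRKHSEquiv hX).injective

lemma covRKHS.norm_def [CompleteSpace E] (hX : MemLp X 2 μ) (f : covRKHS hX) :
    ‖f‖ = ‖covRKHSEquiv hX f‖ := rfl

instance [CompleteSpace E] (hX : MemLp X 2 μ) : InnerProductSpace ℝ (covRKHS hX) where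
  inner f h := inner ℝ (covRKHSEquiv hX f) (covRKHSEquiv hX h)
  norm_smul_le c f := by
    rw [covRKHS.norm_def, covRKHS.norm_def, map_smul, norm_smul]
  norm_sq_eq_re_inner f := by
    rw [covRKHS.norm_def]
    exact norm_sq_eq_re_inner (𝕜 := ℝ) _
  conj_inner_symm f h := inner_conj_symm _ _
  add_left f h k := by rw [map_add, inner_add_left]
  smul_left f h c := by
    rw [map_smul]
    exact inner_smul_left (𝕜 := ℝ) (covRKHSEquiv hX f) (covRKHSEquiv hX h) c

lemma covRKHS.inner_def [CompleteSpace E] (hX : MemLp X 2 μ) (f h : covRKHS hX) :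
    inner ℝ f h = inner ℝ (covRKHSEquiv hX f) (covRKHSEquiv hX h) := rfl

/-- The norm of `H_X` is the infimum of the `L²`-norms of the representing elements of `G_X`. -/
lemma covRKHS.norm_eq_sInf [CompleteSpace E] (hX : MemLp X 2 μ) (f : covRKHS hX) :
    ‖f‖ = sInf {r | ∃ g : gaussSpace hX, toCovRKHS hX g = f ∧ r = ‖g‖} := by
  have h : {r | ∃ g : gaussSpace hX, toCovRKHS hX g = f ∧ r = ‖g‖} = {‖f‖} := by
    ext r
    simp only [Set.mem_ofPred_eq, Set.mem_singleton_iff]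
    constructor
    · rintro ⟨g, rfl, rfl⟩
      rw [covRKHS.norm_def]
      exact congrArg norm ((covRKHSEquiv hX).apply_symm_apply g).symm
    · rintro rfl
      exact ⟨covRKHSEquiv hX f, (covRKHSEquiv hX).symm_apply_apply f, rfl⟩
  rw [h, csInf_singleton]

/-- `covRKHSEquiv` as an isometry. -/
def covRKHSIsometry [CompleteSpace E] (hX : MemLp X 2 μ) : covRKHS hX ≃ₗᵢ[ℝ] gaussSpace hX where
  toLinearEquiv := covRKHSEquiv hX
  norm_map' _ := rfl

instance [CompleteSpace E] (hX : MemLp X 2 μ) : CompleteSpace (covRKHS hX) :=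
  haveI : CompleteSpace (gaussSpace hX) :=
    (Submodule.isClosed_topologicalClosure _).completeSpace_coe
  (covRKHSIsometry hX).symm.toIsometryEquiv.completeSpace_iff.1 ‹_›

/-- The kernel section `k_X(·, e')` as an element of `H_X`. -/
def kernelSection [CompleteSpace E] (hX : MemLp X 2 μ) (e : DualBall E) : covRKHS hX :=
  toCovRKHS hX ⟨dualToL2 hX e, dualToL2_mem hX e⟩

lemma toFun_kernelSection [CompleteSpace E] (hX : MemLp X 2 μ) (e : DualBall E) :
    covRKHS.toFun hX (kernelSection hX e) = fun e₁ => covKernel X μ e₁ e := by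
  funext e₁
  rw [kernelSection, toFun_toCovRKHS, real_inner_comm]
  change inner ℝ (((⟨dualToL2 hX e₁, dualToL2_mem hX e₁⟩ : gaussSpace hX)) : Lp ℝ 2 μ) _ = _
  rw [inner_dualToL2, covKernel, cov_apply hX]
  congr 1
  refine integral_congr_ae ?_
  filter_upwards [((e₁ : StrongDual ℝ E).comp_memLp' hX).coeFn_toLp] with ω hω
  change (((e₁ : StrongDual ℝ E).comp_memLp' hX).toLp _ ω) • _ = _
  simp [hω]

/-- The reproducing property of `k_X` in `H_X`. -/
lemma inner_kernelSection [CompleteSpace E] (hX : MemLp X 2 μ) (f : covRKHS hX) (e : DualBall E) :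
    inner ℝ f (kernelSection hX e) = covRKHS.toFun hX f e := by
  obtain ⟨g, rfl⟩ := (toCovRKHS_bijective hX).2 f
  rw [toFun_toCovRKHS, covRKHS.inner_def, kernelSection]
  have h : ∀ g, covRKHSEquiv hX (toCovRKHS hX g) = g := fun g =>
    (covRKHSEquiv hX).apply_symm_apply g
  rw [h, h]
  rfl

/-- `H_X` is a reproducing kernel Hilbert space of functions on the unit ball of the dual. -/
instance [CompleteSpace E] (hX : MemLp X 2 μ) : RKHS ℝ (covRKHS hX) (DualBall E) ℝ where
  coeCLM :=
    { covRKHS.toFun hX with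
      cont := by
        refine continuous_pi fun e => ?_
        have : (fun f : covRKHS hX => covRKHS.toFun hX f e) =
            fun f => inner ℝ f (kernelSection hX e) :=
          funext fun f => (inner_kernelSection hX f e).symm
        change Continuous fun f : covRKHS hX => covRKHS.toFun hX f e
        rw [this]
        fun_prop }
  coeCLM_injective := Subtype.val_injective

/-- The kernel of the reproducing kernel Hilbert space `H_X` is `k_X`. -/
lemma kerFun_eq_kernelSection [CompleteSpace E] (hX : MemLp X 2 μ) (e : DualBall E) :
    RKHS.kerFun (covRKHS hX) e (1 : ℝ) = kernelSection hX e := by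
  refine ext_inner_left ℝ fun f => ?_
  rw [RKHS.inner_kerFun, inner_kernelSection]
  change inner ℝ (covRKHS.toFun hX f e) (1 : ℝ) = _
  simp

/-- `H(𝓔)`, the closed linear span in `H_X` of the kernel sections `k_X(·, e')`, `e' ∈ 𝓔`. -/
def closedSpan [CompleteSpace E] (hX : MemLp X 2 μ) (𝓔 : Set (DualBall E)) :
    Submodule ℝ (covRKHS hX) :=
  (Submodule.span ℝ (kernelSection hX '' 𝓔)).topologicalClosure

instance [CompleteSpace E] (hX : MemLp X 2 μ) (𝓔 : Set (DualBall E)) :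
    (closedSpan hX 𝓔).HasOrthogonalProjection :=
  inferInstanceAs (Submodule.span ℝ (kernelSection hX '' 𝓔)).topologicalClosure.HasOrthogonalProjection

/-- The σ-algebra generated by the real random variables `e'(X)`, `e' ∈ 𝓔`. -/
@[reducible] def sigmaOf (X : Ω → E) (𝓔 : Set (DualBall E)) : MeasurableSpace Ω :=
  ⨆ e ∈ 𝓔, MeasurableSpace.comap (fun ω => (e : StrongDual ℝ E) (X ω)) (borel ℝ)

end Spaces

end

end GaussianConditioning

/-! The Gaussian Hilbert space `G_X` is a linear space of jointly Gaussian variables, so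
orthogonality in it is independence. The isometry between `H_X` and `G_X` carries the projection
onto `H(𝓔)` to `L²`: it splits `e'(X) = y + r`, where `y` is an `L²`-limit of combinations of the
`f(X)`, `f ∈ 𝓔`, hence measurable for their σ-algebra, and `r` is orthogonal to all of them, hence
independent of that σ-algebra. So `y` is the conditional expectation of `e'(X)`, that is, `e'(X_𝓔)`
(`condExp_dual_ae_eq_projGauss`).

All functionals of `X_𝓔` and `X - X_𝓔` thus lie in `G_X`, which makes both vectors Gaussian. Kernels
are `L²` inner products (`covKernel_eq_inner`), and the kernel identities become statements about an
orthogonal projection. The norm identity holds because a covariance operator has norm equal to the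
supremum of its kernel on the diagonal (`isLUB_covKernel_diag`), here `‖r‖²`. -/

namespace GaussianConditioning

/-! ### Gaussian laws and characteristic functions on `L²` -/

section GaussianLaw

variable {Ω : Type*} [MeasurableSpace Ω] {μ : Measure Ω}

/-- A random vector all of whose one-dimensional projections are Gaussian is Gaussian. -/
lemma hasGaussianLaw_of_forall_dual {F : Type*} [NormedAddCommGroup F] [NormedSpace ℝ F]
    [MeasurableSpace F] [BorelSpace F] {Y : Ω → F} (hY : AEMeasurable Y μ)
    (h : ∀ L : StrongDual ℝ F, HasGaussianLaw (fun ω => L (Y ω)) μ) : HasGaussianLaw Y μ where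
  isGaussian_map := by
    refine ⟨fun L => ?_⟩
    have hL : AEMeasurable L (μ.map Y) := L.continuous.measurable.aemeasurable
    rw [AEMeasurable.map_map_of_aemeasurable hL hY, integral_map hY hL.aestronglyMeasurable,
      variance_map hL hY]
    exact (h L).map_eq_gaussianReal

lemma norm_cexp_ofReal_mul_I_sub_le (a b : ℝ) :
    ‖Complex.exp (a * Complex.I) - Complex.exp (b * Complex.I)‖ ≤ ‖a - b‖ := by
  have h : Complex.exp (a * Complex.I) - Complex.exp (b * Complex.I) =
      Complex.exp (b * Complex.I) * (Complex.exp (Complex.I * ((a - b : ℝ) : ℂ)) - 1) := by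
    rw [mul_sub, ← Complex.exp_add, mul_one]
    congr 2
    push_cast
    ring
  rw [h, norm_mul, Complex.norm_exp_ofReal_mul_I, one_mul]
  exact Real.norm_exp_I_mul_ofReal_sub_one_le

lemma integrable_cexp_ofReal_mul_I [IsFiniteMeasure μ] {f : Ω → ℝ} (hf : AEStronglyMeasurable f μ) :
    Integrable (fun ω => Complex.exp (f ω * Complex.I)) μ := by
  refine Integrable.of_bound (C := 1) ?_ (Filter.Eventually.of_forall fun ω => ?_)
  · exact (by fun_prop : Continuous fun x : ℝ =>
      Complex.exp (x * Complex.I)).comp_aestronglyMeasurable hf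
  · rw [Complex.norm_exp_ofReal_mul_I]

lemma integral_norm_le_norm_Lp_two [IsProbabilityMeasure μ] (g : Lp ℝ 2 μ) :
    ∫ ω, ‖g ω‖ ∂μ ≤ ‖g‖ := by
  rw [integral_norm_eq_lintegral_enorm (Lp.aestronglyMeasurable g), Lp.norm_def,
    ← eLpNorm_one_eq_lintegral_enorm]
  exact ENNReal.toReal_mono (Lp.eLpNorm_ne_top g)
    (eLpNorm_le_eLpNorm_of_exponent_le (by norm_num) (Lp.aestronglyMeasurable g))

/-- The characteristic function at `1` depends continuously on an element of `L²`. -/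
lemma continuous_integral_cexp [IsProbabilityMeasure μ] :
    Continuous fun g : Lp ℝ 2 μ => ∫ ω, Complex.exp (g ω * Complex.I) ∂μ := by
  -- The constant is 1 because `t ↦ exp(it)` is 1-Lipschitz and the `L¹` norm is at most the `L²`
  -- norm on a probability space.
  refine (LipschitzWith.of_dist_le_mul (K := 1) fun g h => ?_).continuous
  rw [NNReal.coe_one, one_mul, dist_eq_norm, dist_eq_norm,
    ← integral_sub (integrable_cexp_ofReal_mul_I (Lp.aestronglyMeasurable g))
      (integrable_cexp_ofReal_mul_I (Lp.aestronglyMeasurable h))]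
  refine (norm_integral_le_of_norm_le (g := fun ω => ‖(g - h) ω‖)
    ((Lp.memLp (g - h)).integrable (by norm_num)).norm ?_).trans
    (integral_norm_le_norm_Lp_two (g - h))
  filter_upwards [Lp.coeFn_sub g h] with ω hω
  rw [hω]
  exact norm_cexp_ofReal_mul_I_sub_le _ _

lemma norm_toLp_two_sq {f : Ω → ℝ} (hf : MemLp f 2 μ) : ‖hf.toLp‖ ^ 2 = ∫ ω, f ω ^ 2 ∂μ := by
  rw [← real_inner_self_eq_norm_sq, L2.inner_def]
  refine integral_congr_ae ?_
  filter_upwards [hf.coeFn_toLp] with ω hω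
  simp [hω]

end GaussianLaw

/-! ### The space `G_X` consists of jointly Gaussian variables -/

section GaussSpace

variable {Ω E : Type*} [MeasurableSpace Ω] [NormedAddCommGroup E] [NormedSpace ℝ E]
  [CompleteSpace E] [MeasurableSpace E] [BorelSpace E] {X : Ω → E} {μ : Measure Ω}

lemma integral_cexp_dualToL2 (hX : MemLp X 2 μ) (hG : HasGaussianLaw X μ)
    (h0 : ∫ ω, X ω ∂μ = 0) (e : StrongDual ℝ E) :
    ∫ ω, Complex.exp (dualToL2 hX e ω * Complex.I) ∂μ =
      Complex.exp (-‖dualToL2 hX e‖ ^ 2 / 2) := by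
  have := hG.isProbabilityMeasure
  have hGe : HasGaussianLaw (fun ω => e (X ω)) μ := hG.map_fun e
  have hmean : ∫ ω, e (X ω) ∂μ = 0 := by
    rw [e.integral_comp_comm (hX.integrable (by norm_num)), h0, map_zero]
  have hvar : Var[fun ω => e (X ω); μ] = ‖dualToL2 hX e‖ ^ 2 := by
    rw [variance_of_integral_eq_zero hGe.aemeasurable hmean]
    exact (norm_toLp_two_sq (e.comp_memLp' hX)).symm
  have hcongr : ∫ ω, Complex.exp (dualToL2 hX e ω * Complex.I) ∂μ =
      ∫ ω, Complex.exp (e (X ω) * Complex.I) ∂μ := by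
    refine integral_congr_ae ?_
    filter_upwards [(e.comp_memLp' hX).coeFn_toLp] with ω hω
    change Complex.exp (((e.comp_memLp' hX).toLp _ ω : ℝ) * Complex.I) = _
    rw [hω]
    rfl
  have hc := charFun_gaussianReal (μ := 0) (v := (‖dualToL2 hX e‖ ^ 2).toNNReal) 1
  have hmap := hGe.map_eq_gaussianReal
  rw [hmean, hvar] at hmap
  rw [← hmap, charFun_apply_real, integral_map hGe.aemeasurable (by fun_prop)] at hc
  rw [hcongr]
  simpa [neg_div] using hc

/-- Both sides are continuous in `L²`, so the identity passes from the variables `e(X)` to their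
closure. -/
lemma integral_cexp_gaussSpace (hX : MemLp X 2 μ) (hG : HasGaussianLaw X μ)
    (h0 : ∫ ω, X ω ∂μ = 0) {g : Lp ℝ 2 μ} (hg : g ∈ gaussSpace hX) :
    ∫ ω, Complex.exp (g ω * Complex.I) ∂μ = Complex.exp (-‖g‖ ^ 2 / 2) := by
  have := hG.isProbabilityMeasure
  have hclosed : IsClosed {g : Lp ℝ 2 μ | ∫ ω, Complex.exp (g ω * Complex.I) ∂μ =
      Complex.exp (-‖g‖ ^ 2 / 2)} :=
    isClosed_eq continuous_integral_cexp (by fun_prop)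
  refine closure_minimal ?_ hclosed hg
  rintro _ ⟨e, rfl⟩
  exact integral_cexp_dualToL2 hX hG h0 e

/-- Elements of `G_X` are centred Gaussian with variance their squared norm. -/
lemma map_gaussSpace (hX : MemLp X 2 μ) (hG : HasGaussianLaw X μ)
    (h0 : ∫ ω, X ω ∂μ = 0) {g : Lp ℝ 2 μ} (hg : g ∈ gaussSpace hX) :
    μ.map g = gaussianReal 0 (‖g‖ ^ 2).toNNReal := by
  have := hG.isProbabilityMeasure
  have hm : AEMeasurable g μ := (Lp.aestronglyMeasurable g).aemeasurable
  have : IsProbabilityMeasure (μ.map g) := Measure.isProbabilityMeasure_map hm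
  refine Measure.ext_of_charFun (funext fun t => ?_)
  rw [charFun_gaussianReal, charFun_apply_real, integral_map hm (by fun_prop)]
  -- The characteristic function of `g` at `t` is that of `t • g` at 1, and `G_X` is closed under
  -- scaling.
  have ht := integral_cexp_gaussSpace hX hG h0 ((gaussSpace hX).smul_mem t hg)
  have hcongr : ∫ ω, Complex.exp ((t • g : Lp ℝ 2 μ) ω * Complex.I) ∂μ =
      ∫ ω, Complex.exp (t * g ω * Complex.I) ∂μ := by
    refine integral_congr_ae ?_
    filter_upwards [Lp.coeFn_smul t g] with ω hω
    simp [hω]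
  have hsq : ‖t • g‖ ^ 2 = t ^ 2 * ‖g‖ ^ 2 := by
    rw [norm_smul, mul_pow, Real.norm_eq_abs, sq_abs]
  rw [← hcongr, ht, ← Complex.ofReal_pow, hsq, Real.coe_toNNReal _ (sq_nonneg _)]
  congr 1
  push_cast
  ring

lemma hasGaussianLaw_gaussSpace (hX : MemLp X 2 μ) (hG : HasGaussianLaw X μ)
    (h0 : ∫ ω, X ω ∂μ = 0) {g : Lp ℝ 2 μ} (hg : g ∈ gaussSpace hX) : HasGaussianLaw g μ where
  isGaussian_map := by
    rw [map_gaussSpace hX hG h0 hg]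
    infer_instance

lemma integral_gaussSpace (hX : MemLp X 2 μ) (hG : HasGaussianLaw X μ)
    (h0 : ∫ ω, X ω ∂μ = 0) {g : Lp ℝ 2 μ} (hg : g ∈ gaussSpace hX) : ∫ ω, g ω ∂μ = 0 := by
  have h := integral_map (f := fun x : ℝ => x) (Lp.aestronglyMeasurable g).aemeasurable
    (by fun_prop)
  rw [← h, map_gaussSpace hX hG h0 hg, integral_id_gaussianReal]

/-- Any family in `G_X` is a Gaussian process. -/
lemma isGaussianProcess_gaussSpace (hX : MemLp X 2 μ) (hG : HasGaussianLaw X μ)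
    (h0 : ∫ ω, X ω ∂μ = 0) {T : Type*} (g : T → gaussSpace hX) :
    IsGaussianProcess (fun t => ⇑(g t : Lp ℝ 2 μ)) μ where
  hasGaussianLaw I := by
    refine hasGaussianLaw_of_forall_dual (aemeasurable_pi_lambda _ fun t =>
      (Lp.aestronglyMeasurable _).aemeasurable) fun L => ?_
    classical
    -- With the coordinates `c` of `L`, the projection of the family along `L` is a.e. the single
    -- element `∑ c t • g t` of `G_X`.
    let c : I → ℝ := fun t => L (Pi.single t 1)
    have hmem := hasGaussianLaw_gaussSpace hX hG h0 (∑ t, c t • g t : gaussSpace hX).2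
    refine hmem.congr ?_
    have hsum : ((∑ t, c t • g t : gaussSpace hX) : Lp ℝ 2 μ) =
        ∑ t : I, c t • (g t : Lp ℝ 2 μ) := by
      simp
    have hsmul : ∀ᵐ ω ∂μ, ∀ t : I, (c t • (g t : Lp ℝ 2 μ) : Lp ℝ 2 μ) ω =
        c t * (g t : Lp ℝ 2 μ) ω :=
      ae_all_iff.2 fun t => by
        filter_upwards [Lp.coeFn_smul (c t) (g t : Lp ℝ 2 μ)] with ω hω
        simp [hω]
    rw [hsum]
    filter_upwards [Lp.coeFn_finsetSum Finset.univ fun t : I => c t • (g t : Lp ℝ 2 μ), hsmul]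
      with ω h1 h2
    rw [h1]
    have hL := L.toLinearMap.pi_apply_eq_sum_univ (I.restrict fun t => (g t : Lp ℝ 2 μ) ω)
    simp only [ContinuousLinearMap.coe_coe] at hL
    rw [hL, Finset.sum_apply]
    refine Finset.sum_congr rfl fun t _ => ?_
    rw [h2, smul_eq_mul, mul_comm]
    congr 1
    refine congrArg L (funext fun i => ?_)
    simp [Pi.single_apply, eq_comm]

end GaussSpace

/-! ### Measurability, and recovering the operator from its kernel -/

section Basic

variable {Ω E : Type*} [MeasurableSpace Ω] [NormedAddCommGroup E] [NormedSpace ℝ E] {X : Ω → E}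

lemma sigmaOf_le [MeasurableSpace E] [BorelSpace E] (hXm : StronglyMeasurable X) (𝓔 : Set (DualBall E)) :
    sigmaOf X 𝓔 ≤ ‹MeasurableSpace Ω› := by
  refine iSup₂_le fun e _ => ?_
  rw [← BorelSpace.measurable_eq (α := ℝ)]
  exact ((e : StrongDual ℝ E).continuous.measurable.comp hXm.measurable).comap_le

/-- The covariance operator is determined by its kernel, additively. -/
lemma cov_sub_eq_of_covKernel {μ : Measure Ω} {Y Z : Ω → E}
    (h : ∀ e f, covKernel Z μ e f = covKernel X μ e f - covKernel Y μ e f) :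
    cov Z μ = cov X μ - cov Y μ := by
  -- The kernel sees only the unit ball; homogeneity extends the identity to all functionals.
  have hball : ∀ e : StrongDual ℝ E, ∃ c : ℝ, c ≠ 0 ∧
      c • e ∈ Metric.closedBall (0 : StrongDual ℝ E) 1 := by
    intro e
    refine ⟨(‖e‖ + 1)⁻¹, by positivity, ?_⟩
    rw [mem_closedBall_zero_iff, norm_smul, norm_inv, Real.norm_of_nonneg (by positivity),
      inv_mul_le_iff₀ (by positivity)]
    linarith
  ext e
  refine (SeparatingDual.eq_iff_forall_dual_eq (R := ℝ)).2 fun f => ?_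
  obtain ⟨c, hc, hce⟩ := hball e
  obtain ⟨d, hd, hdf⟩ := hball f
  have := h ⟨c • e, hce⟩ ⟨d • f, hdf⟩
  simp only [covKernel, map_smul, smul_apply, smul_eq_mul] at this
  simp only [sub_apply, map_sub]
  have h2 : d * c * f (cov Z μ e) = d * c * (f (cov X μ e) - f (cov Y μ e)) := by linarith
  exact mul_left_cancel₀ (mul_ne_zero hd hc) h2

end Basic

/-! ### The projection onto `H(𝓔)` seen in `L²` -/

section Projection

variable {Ω E : Type*} [MeasurableSpace Ω] [NormedAddCommGroup E] [NormedSpace ℝ E]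
  [CompleteSpace E] {X : Ω → E} {μ : Measure Ω}

/-- The image in `G_X` of the orthogonal projection of the kernel section at `e'` onto `H(𝓔)`. -/
noncomputable def projGauss (hX : MemLp X 2 μ) (𝓔 : Set (DualBall E)) (e : StrongDual ℝ E) :
    gaussSpace hX :=
  covRKHSEquiv hX ((closedSpan hX 𝓔).starProjection
    (toCovRKHS hX ⟨dualToL2 hX e, dualToL2_mem hX e⟩))

lemma covRKHSEquiv_toCovRKHS (hX : MemLp X 2 μ) (g : gaussSpace hX) :
    covRKHSEquiv hX (toCovRKHS hX g) = g :=
  (covRKHSEquiv hX).apply_symm_apply g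

lemma toCovRKHS_projGauss (hX : MemLp X 2 μ) (𝓔 : Set (DualBall E)) (e : StrongDual ℝ E) :
    toCovRKHS hX (projGauss hX 𝓔 e) = (closedSpan hX 𝓔).starProjection
      (toCovRKHS hX ⟨dualToL2 hX e, dualToL2_mem hX e⟩) :=
  (covRKHSEquiv hX).symm_apply_apply _

lemma inner_toCovRKHS (hX : MemLp X 2 μ) (g h : gaussSpace hX) :
    inner ℝ (toCovRKHS hX g) (toCovRKHS hX h) = inner ℝ (g : Lp ℝ 2 μ) (h : Lp ℝ 2 μ) := by
  rw [covRKHS.inner_def, covRKHSEquiv_toCovRKHS, covRKHSEquiv_toCovRKHS, Submodule.coe_inner]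

lemma norm_toCovRKHS (hX : MemLp X 2 μ) (g : gaussSpace hX) :
    ‖toCovRKHS hX g‖ = ‖(g : Lp ℝ 2 μ)‖ := by
  rw [covRKHS.norm_def, covRKHSEquiv_toCovRKHS, Submodule.coe_norm]

/-- An orthogonal projection is self-adjoint and idempotent: `⟪Pe, f⟫ = ⟪Pe, Pf⟫`. -/
lemma inner_dualToL2_projGauss (hX : MemLp X 2 μ) (𝓔 : Set (DualBall E))
    (e f : StrongDual ℝ E) :
    inner ℝ (projGauss hX 𝓔 e : Lp ℝ 2 μ) (dualToL2 hX f) =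
      inner ℝ (projGauss hX 𝓔 e : Lp ℝ 2 μ) (projGauss hX 𝓔 f : Lp ℝ 2 μ) := by
  rw [← inner_toCovRKHS, toCovRKHS_projGauss, toCovRKHS_projGauss,
    ← Submodule.inner_starProjection_left_eq_right,
    Submodule.starProjection_eq_self_iff.2 (Submodule.starProjection_apply_mem _ _),
    ← toCovRKHS_projGauss, inner_toCovRKHS]

lemma inner_sub_projGauss_dualToL2 (hX : MemLp X 2 μ) {𝓔 : Set (DualBall E)}
    (e : StrongDual ℝ E) {f : DualBall E} (hf : f ∈ 𝓔) :
    inner ℝ (dualToL2 hX e - projGauss hX 𝓔 e : Lp ℝ 2 μ) (dualToL2 hX f) = 0 := by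
  have hmem : kernelSection hX f ∈ closedSpan hX 𝓔 :=
    Submodule.le_topologicalClosure _ (Submodule.subset_span (Set.mem_image_of_mem _ hf))
  have h := Submodule.starProjection_inner_eq_zero (K := closedSpan hX 𝓔)
    (toCovRKHS hX ⟨dualToL2 hX e, dualToL2_mem hX e⟩) _ hmem
  rw [← toCovRKHS_projGauss, ← map_sub, kernelSection, inner_toCovRKHS] at h
  exact h

/-- The projection onto `H(𝓔)` corresponds to random variables measurable with respect to `𝓔`. -/
lemma aestronglyMeasurable_projGauss [IsProbabilityMeasure μ] (hX : MemLp X 2 μ)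
    (𝓔 : Set (DualBall E)) (hm : sigmaOf X 𝓔 ≤ ‹MeasurableSpace Ω›) (e : StrongDual ℝ E) :
    AEStronglyMeasurable[sigmaOf X 𝓔] (projGauss hX 𝓔 e : Lp ℝ 2 μ) μ := by
  -- `S` collects the elements of `H_X` represented by `sigmaOf X 𝓔`-measurable variables; it is
  -- closed and contains the generators of `H(𝓔)`.
  let S : Submodule ℝ (covRKHS hX) :=
    (lpMeas ℝ ℝ (sigmaOf X 𝓔) 2 μ).comap
      ((gaussSpace hX).subtype ∘ₗ (covRKHSEquiv hX).toLinearMap)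
  have hcont : Continuous fun f : covRKHS hX => (covRKHSEquiv hX f : Lp ℝ 2 μ) :=
    continuous_subtype_val.comp (covRKHSIsometry hX).continuous
  have hS : IsClosed (S : Set (covRKHS hX)) := (isClosed_aestronglyMeasurable hm).preimage hcont
  have hle : closedSpan hX 𝓔 ≤ S := by
    refine Submodule.topologicalClosure_minimal _ (Submodule.span_le.2 ?_) hS
    rintro _ ⟨f, hf, rfl⟩
    change AEStronglyMeasurable[sigmaOf X 𝓔] (covRKHSEquiv hX (toCovRKHS hX _) : Lp ℝ 2 μ) μ
    rw [covRKHSEquiv_toCovRKHS]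
    have hmeas : Measurable[sigmaOf X 𝓔] fun ω => (f : StrongDual ℝ E) (X ω) := by
      rw [measurable_iff_comap_le, BorelSpace.measurable_eq (α := ℝ)]
      exact le_iSup₂_of_le f hf le_rfl
    exact ⟨_, hmeas.stronglyMeasurable, ((f : StrongDual ℝ E).comp_memLp' hX).coeFn_toLp⟩
  exact hle (Submodule.starProjection_apply_mem _ _)

end Projection

/-! ### Conditional expectation as projection -/

section Conditional

variable {Ω E : Type*} [MeasurableSpace Ω] [NormedAddCommGroup E] [NormedSpace ℝ E]
  [CompleteSpace E] [MeasurableSpace E] [BorelSpace E] {X : Ω → E} {μ : Measure Ω}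

/-- An element of `G_X` uncorrelated with `e'(X)`, `e' ∈ 𝓔`, is independent of them. -/
lemma indep_sigmaOf_of_inner_eq_zero (hXm : StronglyMeasurable X) (hX : MemLp X 2 μ)
    (hG : HasGaussianLaw X μ) (h0 : ∫ ω, X ω ∂μ = 0) (𝓔 : Set (DualBall E))
    {g : Lp ℝ 2 μ} (hg : g ∈ gaussSpace hX)
    (horth : ∀ f ∈ 𝓔, inner ℝ g (dualToL2 hX (f : StrongDual ℝ E)) = 0) :
    Indep (MeasurableSpace.comap g inferInstance) (sigmaOf X 𝓔) μ := by
  have := hG.isProbabilityMeasure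
  have hcoe : ∀ f : StrongDual ℝ E, (dualToL2 hX f : Lp ℝ 2 μ) =ᵐ[μ] fun ω => f (X ω) :=
    fun f => (f.comp_memLp' hX).coeFn_toLp
  let A : Unit → Ω → ℝ := fun _ => g
  let B : 𝓔 → Ω → ℝ := fun f ω => ((f : DualBall E) : StrongDual ℝ E) (X ω)
  have hB : ∀ f, Measurable (B f) := fun f =>
    ((f : DualBall E) : StrongDual ℝ E).continuous.measurable.comp hXm.measurable
  -- Joint Gaussianity of `g` with the whole family is what turns zero covariance into independence.
  have hproc : IsGaussianProcess (Sum.elim A B) μ := by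
    refine (isGaussianProcess_gaussSpace hX hG h0 (Sum.elim (fun _ : Unit => ⟨g, hg⟩)
      fun f : 𝓔 => ⟨dualToL2 hX (f : DualBall E), dualToL2_mem hX _⟩)).congr ?_
    rintro (_ | f)
    · exact Filter.EventuallyEq.rfl
    · exact hcoe _
  have hind := hproc.indepFun_of_covariance_eq_zero
    (fun _ => (Lp.aestronglyMeasurable g).aemeasurable) (fun f => (hB f).aemeasurable)
    (fun _ f => by
      change cov[⇑g, ⇑((f : DualBall E) : StrongDual ℝ E) ∘ X; μ] = 0
      rw [covariance_eq_sub (Lp.memLp g) (((f : DualBall E) : StrongDual ℝ E).comp_memLp' hX),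
        integral_gaussSpace hX hG h0 hg, zero_mul, sub_zero, ← horth f f.2, L2.inner_def]
      refine integral_congr_ae ?_
      filter_upwards [hcoe (f : DualBall E)] with ω hω
      simp [hω, mul_comm])
  rw [IndepFun_iff_Indep] at hind
  refine indep_of_indep_of_le_left (indep_of_indep_of_le_right hind ?_) ?_
  · refine iSup₂_le fun f hf => ?_
    rw [← BorelSpace.measurable_eq (α := ℝ)]
    exact measurable_iff_comap_le.1
      ((measurable_pi_apply (⟨f, hf⟩ : 𝓔)).comp (comap_measurable fun ω t => B t ω))
  · exact measurable_iff_comap_le.1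
      ((measurable_pi_apply ()).comp (comap_measurable fun ω s => A s ω))

/-- The conditional expectation of `e'(X)` given `𝓔` is the projection of `e'(X)`. -/
lemma condExp_dual_ae_eq_projGauss (hXm : StronglyMeasurable X) (hX : MemLp X 2 μ)
    (hG : HasGaussianLaw X μ) (h0 : ∫ ω, X ω ∂μ = 0) (𝓔 : Set (DualBall E))
    (e : StrongDual ℝ E) :
    (fun ω => e ((μ[X | sigmaOf X 𝓔]) ω)) =ᵐ[μ] (projGauss hX 𝓔 e : Lp ℝ 2 μ) := by
  have := hG.isProbabilityMeasure
  have hm := sigmaOf_le hXm 𝓔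
  set y : Lp ℝ 2 μ := (projGauss hX 𝓔 e : gaussSpace hX).1 with hy
  set r : Lp ℝ 2 μ := dualToL2 hX e - y with hr
  have hrmem : r ∈ gaussSpace hX := sub_mem (dualToL2_mem hX e) (projGauss hX 𝓔 e).2
  have hint : ∀ g : Lp ℝ 2 μ, Integrable g μ := fun g => (Lp.memLp g).integrable (by norm_num)
  have hrm : Measurable r := (Lp.stronglyMeasurable r).measurable
  -- Conditioning a variable on an independent σ-algebra leaves its mean, here 0.
  have hcr : μ[r | sigmaOf X 𝓔] =ᵐ[μ] fun _ => (0 : ℝ) := by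
    have := condExp_indep_eq hrm.comap_le hm (comap_measurable r).stronglyMeasurable
      (indep_sigmaOf_of_inner_eq_zero hXm hX hG h0 𝓔 hrmem fun f hf => inner_sub_projGauss_dualToL2 hX e hf)
    rwa [integral_gaussSpace hX hG h0 hrmem] at this
  have hcy : μ[y | sigmaOf X 𝓔] =ᵐ[μ] y :=
    condExp_of_aestronglyMeasurable' hm (aestronglyMeasurable_projGauss hX 𝓔 hm e) (hint y)
  have hsum : (e ∘ X) =ᵐ[μ] ⇑r + ⇑y := by
    filter_upwards [(e.comp_memLp' hX).coeFn_toLp, Lp.coeFn_sub (dualToL2 hX e) y] with ω h1 h2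
    rw [Pi.add_apply, hr, h2, Pi.sub_apply, sub_add_cancel]
    exact h1.symm
  filter_upwards [e.comp_condExp_comm (m := sigmaOf X 𝓔) (hX.integrable (by norm_num)),
    condExp_congr_ae (m := sigmaOf X 𝓔) hsum, condExp_add (hint r) (hint y) (sigmaOf X 𝓔),
    hcr, hcy] with ω h1 h2 h3 h4 h5
  rw [Function.comp_apply] at h1
  rw [h1, h2, h3, Pi.add_apply, h4, h5, zero_add]

end Conditional

/-! ### The kernel and the norm of the covariance operator -/

section Kernel

variable {Ω E : Type*} [MeasurableSpace Ω] [NormedAddCommGroup E] [NormedSpace ℝ E]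
  [CompleteSpace E] {X : Ω → E} {μ : Measure Ω}

lemma covKernel_eq_inner (hX : MemLp X 2 μ) (e f : DualBall E) :
    covKernel X μ e f = inner ℝ (dualToL2 hX e) (dualToL2 hX f) := by
  rw [← congrFun (toFun_kernelSection hX f) e, kernelSection, toFun_toCovRKHS, real_inner_comm]

/-- The norm of the covariance operator is the supremum of the kernel on the diagonal. -/
lemma isLUB_covKernel_diag (hX : MemLp X 2 μ) :
    IsLUB (Set.range fun e : DualBall E => covKernel X μ e e) ‖cov X μ‖ := by
  constructor
  · rintro _ ⟨⟨e, he⟩, rfl⟩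
    rw [mem_closedBall_zero_iff] at he
    calc e (cov X μ e) ≤ ‖e‖ * (‖cov X μ‖ * ‖e‖) :=
          (le_abs_self _).trans ((e.le_opNorm _).trans (by gcongr; exact (cov X μ).le_opNorm e))
      _ ≤ 1 * (‖cov X μ‖ * 1) := by gcongr
      _ = ‖cov X μ‖ := by ring
  · intro C hC
    have hdiag : ∀ e : DualBall E, ‖dualToL2 hX e‖ ^ 2 ≤ C := fun e => by
      rw [← real_inner_self_eq_norm_sq, ← covKernel_eq_inner]
      exact hC ⟨e, rfl⟩
    have hC0 : 0 ≤ C := (sq_nonneg _).trans (hdiag ⟨0, by simp⟩)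
    have hk : ∀ e f : DualBall E, |covKernel X μ e f| ≤ C := fun e f => by
      rw [covKernel_eq_inner hX]
      refine (abs_real_inner_le_norm _ _).trans ?_
      -- `ab ≤ (a² + b²)/2 ≤ C`, where `a²` and `b²` are diagonal values.
      nlinarith [hdiag e, hdiag f, sq_nonneg (‖dualToL2 hX e‖ - ‖dualToL2 hX f‖)]
    refine ContinuousLinearMap.opNorm_le_of_unit_norm hC0 fun e he => ?_
    -- Hahn–Banach: a functional in the unit ball norming `cov X μ e` makes the operator bound a
    -- bound on the kernel.
    obtain ⟨f, hf, hfe⟩ := exists_dual_vector'' ℝ (cov X μ e)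
    have := hk ⟨e, by simp [he]⟩ ⟨f, by simpa using hf⟩
    rw [covKernel, hfe] at this
    simpa using this

end Kernel

end GaussianConditioning

theorem mainTheorem5
    {Ω : Type*} [MeasurableSpace Ω] (μ : Measure Ω) [IsProbabilityMeasure μ]
    {E : Type*} [NormedAddCommGroup E] [NormedSpace ℝ E] [CompleteSpace E]
    [SecondCountableTopology E] [MeasurableSpace E] [BorelSpace E]
    (X : Ω → E) (hXmeas : StronglyMeasurable X) (hX : HasGaussianLaw X μ)
    (hX0 : ∫ ω, X ω ∂μ = 0)
    (𝓔 : Set (GaussianConditioning.DualBall E))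
    (XE : Ω → E) (hXE : XE =ᵐ[μ] μ[X | GaussianConditioning.sigmaOf X 𝓔]) :
    -- `X_𝓔` and `X - X_𝓔` are centred Gaussian random variables
    HasGaussianLaw XE μ ∧ ∫ ω, XE ω ∂μ = 0 ∧
    HasGaussianLaw (X - XE) μ ∧ ∫ ω, (X - XE) ω ∂μ = 0 ∧
    -- the functions `k_𝓔(·, e')` are elements `kE e'` of `H_X`
    (∃ kE : GaussianConditioning.DualBall E → GaussianConditioning.covRKHS hX.memLp_two,
      (∀ e' e, kE e' e = GaussianConditioning.covKernel XE μ e e') ∧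
      (∀ e', kE e' = (GaussianConditioning.closedSpan hX.memLp_two 𝓔).starProjection
        (GaussianConditioning.kernelSection hX.memLp_two e')) ∧
      IsLUB (Set.range fun e' => ‖GaussianConditioning.kernelSection hX.memLp_two e' - kE e'‖ ^ 2)
        ‖GaussianConditioning.cov (X - XE) μ‖) ∧
    (∀ e₁ e₂, GaussianConditioning.covKernel (X - XE) μ e₁ e₂ =
      GaussianConditioning.covKernel X μ e₁ e₂ - GaussianConditioning.covKernel XE μ e₁ e₂) ∧
    ‖GaussianConditioning.cov (X - XE) μ‖ =
      ‖GaussianConditioning.cov X μ - GaussianConditioning.cov XE μ‖ := by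
  open GaussianConditioning in
  have hX2 := hX.memLp_two
  have hm := sigmaOf_le hXmeas 𝓔
  have hXEm : AEStronglyMeasurable XE μ :=
    (stronglyMeasurable_condExp.mono hm).aestronglyMeasurable.congr hXE.symm
  have hXEi : Integrable XE μ := integrable_condExp.congr hXE.symm
  have hdual : ∀ e : StrongDual ℝ E,
      (fun ω => e (XE ω)) =ᵐ[μ] (projGauss hX2 𝓔 e : Lp ℝ 2 μ) := fun e => by
    filter_upwards [condExp_dual_ae_eq_projGauss hXmeas hX2 hX hX0 𝓔 e, hXE] with ω h1 h2
    rw [h2, h1]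
  have hdual' : ∀ e : StrongDual ℝ E, (fun ω => e ((X - XE) ω)) =ᵐ[μ]
      (dualToL2 hX2 e - projGauss hX2 𝓔 e : Lp ℝ 2 μ) := fun e => by
    filter_upwards [hdual e, (e.comp_memLp' hX2).coeFn_toLp,
      Lp.coeFn_sub (dualToL2 hX2 e) (projGauss hX2 𝓔 e : Lp ℝ 2 μ)] with ω h1 h2 h3
    rw [h3, Pi.sub_apply, Pi.sub_apply, map_sub, h1]
    exact congrArg (· - _) h2.symm
  have hGE : HasGaussianLaw XE μ := hasGaussianLaw_of_forall_dual hXEm.aemeasurable fun e =>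
    (hasGaussianLaw_gaussSpace hX2 hX hX0 (projGauss hX2 𝓔 e).2).congr (hdual e).symm
  have hGD : HasGaussianLaw (X - XE) μ :=
    hasGaussianLaw_of_forall_dual (hXmeas.aestronglyMeasurable.sub hXEm).aemeasurable fun e =>
      (hasGaussianLaw_gaussSpace hX2 hX hX0
        (sub_mem (dualToL2_mem hX2 e) (projGauss hX2 𝓔 e).2)).congr (hdual' e).symm
  have hE0 : ∫ ω, XE ω ∂μ = 0 := by rw [integral_congr_ae hXE, integral_condExp hm, hX0]
  have hE2 := hGE.memLp_two
  have hD2 := hGD.memLp_two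
  -- The map `dualToL2` of `XE` itself is the projection, so `covKernel_eq_inner` also computes the
  -- kernels of `XE` and `X - XE`.
  have hdE : ∀ e, dualToL2 hE2 e = projGauss hX2 𝓔 e := fun e =>
    Lp.ext ((e.comp_memLp' hE2).coeFn_toLp.trans (hdual e))
  have hdD : ∀ e, dualToL2 hD2 e = dualToL2 hX2 e - projGauss hX2 𝓔 e := fun e =>
    Lp.ext ((e.comp_memLp' hD2).coeFn_toLp.trans (hdual' e))
  have hker : ∀ e₁ e₂, covKernel (X - XE) μ e₁ e₂ =
      covKernel X μ e₁ e₂ - covKernel XE μ e₁ e₂ := fun e₁ e₂ => by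
    -- Both cross terms of `⟪e₁ - Pe₁, e₂ - Pe₂⟫` equal `⟪Pe₁, Pe₂⟫`, so exactly one copy is
    -- subtracted.
    rw [covKernel_eq_inner hD2, covKernel_eq_inner hX2, covKernel_eq_inner hE2, hdD, hdD, hdE, hdE,
      inner_sub_left, inner_sub_right, inner_sub_right, inner_dualToL2_projGauss,
      real_inner_comm (projGauss hX2 𝓔 e₂ : Lp ℝ 2 μ) (dualToL2 hX2 e₁),
      inner_dualToL2_projGauss, real_inner_comm (projGauss hX2 𝓔 e₁ : Lp ℝ 2 μ)]
    ring
  refine ⟨hGE, hE0, hGD, ?_, ⟨fun e' => toCovRKHS hX2 (projGauss hX2 𝓔 e'), fun e' e => ?_,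
    fun e' => toCovRKHS_projGauss hX2 𝓔 e', ?_⟩, hker, by rw [cov_sub_eq_of_covKernel hker]⟩
  · simp only [Pi.sub_apply]
    rw [integral_sub hX.integrable hXEi, hX0, hE0, sub_zero]
  · change covRKHS.toFun hX2 _ e = _
    rw [toFun_toCovRKHS, covKernel_eq_inner hE2, hdE, hdE, inner_dualToL2_projGauss,
      real_inner_comm]
  -- The diagonal of the kernel of `X - XE` is `‖e' - Pe'‖²` in `L²`, which the isometry turns into
  -- the squared `H_X`-norm.
  · convert isLUB_covKernel_diag hD2 using 3 with e'
    rw [covKernel_eq_inner hD2, hdD, real_inner_self_eq_norm_sq, kernelSection, ← map_sub,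
      norm_toCovRKHS]
    rfl
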